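/- Let $G=(V,E)$ be a finite directed acyclic graph and let $\mathcal X$ be a set of node values with at least two elements. **Graph functions.** A graph function $f$ assigns to each node $w\in V$ a function that computes a value in $\mathcal X$ from an unobserved term in $\mathcal X$ and the values of the parents of $w$. For an assignment $U:V\to\mathcal X$ of unobserved terms, $f_U(w)\in\mathcal X$ denotes the resulting value of $w$, computed recursively along the edges. For $Z\subseteq V$ and $A_Z:Z\to\mathcal X$, we say that $f_U$ properly conditions on $Z$ if $f_U(z)=A_Z(z)$ for all $z\in Z$. **Unblocked ancestors.** For $w\in V$, let $\mathrm{anc}_Z(w)$ consist of $w$ itself and of all nodes $a$ with a directed path from $a$ to $w$ on which no node other than the endpoint $w$ (so including $a$) lies in $Z$. **Semantic separation.** Nodes $u$ and $v$ are *semantically separated given $Z$* if $f_{U_0}(v)=f_{U_\ell}(v)$ for all graph functions $f$, all $\alpha,\beta\in\mathcal X$, all $A_Z:Z\to\mathcal X$, and all sequences $U_0,\dots,U_\ell$ of assignments $V\to\mathcal X$ such that 1. $f_{U_0}(u)=\alpha$ and $f_{U_0}$ properly conditions on $Z$; 2. $f_{U_1}(u)=\beta$, and $U_1$ differs from $U_0$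 only at nodes of $\mathrm{anc}_Z(u)$; 3. for $i=2,\dots,\ell$, $U_i$ differs from $U_{i-1}$ only at nodes of $\bigcup_z \mathrm{anc}_Z(z)$, where the union is over those $z\in Z$ for which some $a\in\mathrm{anc}_Z(z)$ has $U_{i-2}(a)\ne U_{i-1}(a)$; 4. $1\le\ell\le|V|+1$; 5. $f_{U_\ell}(u)=\beta$ and $f_{U_\ell}$ properly conditions on $Z$. **d-separation.** Let $P$ be an undirected path without repeated nodes, and let $a,b,c$ be consecutive nodes on $P$. The node $b$ is a mediator on $P$ if $a\to b\to c$ or $a\leftarrow b\leftarrow c$, a confounder if $a\leftarrow b\to c$, and a collider if $a\to b\leftarrow c$. Nodes $u,v$ are *d-connected given $Z$* if there is such a path from $u$ to $v$ on which no mediator or confounder lies in $Z$ and every collider has a descendant in $Z$ (every node being a descendant of itself). Otherwise they are *d-separated given $Z$*. **Theorem.** Let $u,v\in V$ be distinct and let $Z\subseteq V$ with $u,v\notin Z$. Then $u$ and $v$ are semantically separated given $Z$ if and only if they are d-separated given $Z$. -/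

import Mathlib

/-- A causal model: a directed graph on `V` without directed cycles. -/
structure CausalModel (V : Type*) extends Digraph V where
  acyclic : ∀ v : V, ¬ Relation.TransGen Adj v v

namespace CausalModel

variable {V : Type*}

/-! ### Paths and d-separation -/

/-- `b` is a mediator of `a` and `c`. -/
def IsMediator (G : CausalModel V) (a b c : V) : Prop :=
  (G.Adj a b ∧ G.Adj b c) ∨ (G.Adj b a ∧ G.Adj c b)

/-- `b` is a confounder of `a` and `c`. -/
def IsConfounder (G : CausalModel V) (a b c : V) : Prop :=
  G.Adj b a ∧ G.Adj b c

/-- `b` is a collider of `a` and `c`. -/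
def IsCollider (G : CausalModel V) (a b c : V) : Prop :=
  G.Adj a b ∧ G.Adj c b

/-- `p` lists the nodes of an undirected path: consecutive nodes are joined by an edge in one of
the two directions, and no node is repeated. -/
def IsUndirectedPath (G : CausalModel V) (p : List V) : Prop :=
  p.IsChain (fun a b => G.Adj a b ∨ G.Adj b a) ∧ p.Nodup

/-- `d` is a descendant of `a`; every node is a descendant of itself. -/
def IsDescendant (G : CausalModel V) (a d : V) : Prop :=
  Relation.ReflTransGen G.Adj a d

/-- `u` and `v` are d-connected given `Z`: some undirected path from `u` to `v`, with list of
internal nodes `l`, has no mediator or confounder in `Z`, and each of its colliders has a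
descendant in `Z`. -/
def DConnected (G : CausalModel V) (Z : Set V) (u v : V) : Prop :=
  ∃ l : List V, G.IsUndirectedPath (u :: (l ++ [v])) ∧
    ∀ a b c : V, [a, b, c] <:+: u :: (l ++ [v]) →
      ((G.IsMediator a b c ∨ G.IsConfounder a b c) → b ∉ Z) ∧
      (G.IsCollider a b c → ∃ z ∈ Z, G.IsDescendant b z)

/-- `u` and `v` are d-separated given `Z`. -/
def DSeparated (G : CausalModel V) (Z : Set V) (u v : V) : Prop :=
  ¬ G.DConnected Z u v

/-! ### Graph functions and their evaluation -/

/-- A graph function assigns to each node a node function, which computes the value of the node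
from its unobserved term and from the values of its parents. -/
def GraphFun (G : CausalModel V) (X : Type*) :=
  (v : V) → X → ({w : V // G.Adj w v} → X) → X

theorem wellFounded_adj [Finite V] (G : CausalModel V) : WellFounded G.Adj := by
  have : Std.Irrefl (Relation.TransGen G.Adj) := ⟨G.acyclic⟩
  have h : WellFounded (Relation.TransGen G.Adj) := Finite.wellFounded_of_trans_of_irrefl _
  exact Subrelation.wf (fun hab => Relation.TransGen.single hab) h

/-- The value `f_U(v)` of each node `v` under the unobserved-terms assignment `U`, computed by
recursion along the edges. -/
noncomputable def eval [Finite V] {G : CausalModel V} {X : Type*} (f : G.GraphFun X)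
    (U : V → X) : V → X :=
  G.wellFounded_adj.fix (fun v val => f v (U v) (fun w => val w.1 w.2))

theorem eval_eq [Finite V] {G : CausalModel V} {X : Type*} (f : G.GraphFun X)
    (U : V → X) (v : V) :
    eval f U v = f v (U v) (fun w => eval f U w.1) :=
  G.wellFounded_adj.fix_eq _ v

/-! ### Semantic separation -/

/-- `f_U` properly conditions on `Z` with conditioned values `A`. -/
def ProperlyConditions [Finite V] {G : CausalModel V} {X : Type*} (f : G.GraphFun X)
    {Z : Set V} (A : Z → X) (U : V → X) : Prop :=
  ∀ z : Z, eval f U z = A z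

/-- The set of unblocked ancestors of `u` given `Z`: the node `u` itself, and each `w` with a
directed path from `w` to `u` on which no node other than the endpoint `u`
(the starting node `w` is included) lies in `Z`. -/
def unblockedAncestors (G : CausalModel V) (Z : Set V) (u : V) : Set V :=
  {w | w = u ∨ Relation.TransGen (fun a b => G.Adj a b ∧ a ∉ Z) w u}

/-- `U 0, …, U ℓ` is a sequence of unobserved-terms assignments that moves the value of `u` from
`α` to `β`, with conditioned values `A` on `Z`. The values of `U` beyond `ℓ` play no role. -/
structure IsRepairSequence [Fintype V] {G : CausalModel V} {X : Type*} (f : G.GraphFun X)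
    {Z : Set V} (A : Z → X) (u : V) (α β : X) (ℓ : ℕ) (U : ℕ → V → X) : Prop where
  initialization : eval f (U 0) u = α ∧ ProperlyConditions f A (U 0)
  catalyst : eval f (U 1) u = β ∧ ∀ a, U 1 a ≠ U 0 a → a ∈ G.unblockedAncestors Z u
  repair : ∀ i, 2 ≤ i → i ≤ ℓ → ∀ a', U i a' ≠ U (i - 1) a' →
    ∃ z ∈ Z, (∃ a ∈ G.unblockedAncestors Z z, U (i - 2) a ≠ U (i - 1) a) ∧
      a' ∈ G.unblockedAncestors Z z
  termination : 1 ≤ ℓ ∧ ℓ ≤ Fintype.card V + 1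
  restored : eval f (U ℓ) u = β ∧ ProperlyConditions f A (U ℓ)

/-- `u` and `v` are semantically separated given `Z`, for node values in `X`. -/
def SemanticallySeparated [Fintype V] (G : CausalModel V) (X : Type*) (Z : Set V)
    (u v : V) : Prop :=
  ∀ (f : G.GraphFun X) (α β : X) (A : Z → X) (ℓ : ℕ) (U : ℕ → V → X),
    IsRepairSequence f A u α β ℓ U → eval f (U 0) v = eval f (U ℓ) v

end CausalModel

/-!
Write `E a b` for an edge `a → b` whose tail `a` is not in `Z`, so that the unblocked ancestors of
`w` are exactly the nodes `a` with `E* a w`. Call two nodes *co-ancestral* if both are unblocked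
ancestors of one node of `Z`, and call `u` and `v` *linked* if a chain of successively co-ancestral
nodes leads from an unblocked ancestor of `u` to one of `v`. Both notions of connection in the
theorem are equivalent to being linked.

*d-connection.* Along a d-connecting path, each maximal stretch between two colliders runs down from
a top node to both of its ends through nodes outside `Z`, and each collider is an unblocked ancestor
of some `z ∈ Z`. Hence the tops of neighbouring stretches are co-ancestral
(`DConnected.linked`). Conversely, a chain of co-ancestral nodes unfolds to an active walk, whose
colliders lie in `Z` (`Linked.exists_isActive`). A loop of an active walk can be cut out
(`IsActive.cut`): if the cut makes a collider of a node `x` that was none before, then the loop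
leaves `x` downwards and, by acyclicity, cannot return to `x` without passing a collider, which is a
descendant of `x` and has itself a descendant in `Z`. So a shortest active walk is a path.

*Semantic connection.* The value of `v` is a function of the values on `Z` and of the unobserved
terms on the unblocked ancestors of `v` (`eval_congr`). If a repair sequence changes the value of
`v`, then some unblocked ancestor of `v` has its term changed, and every node whose term is changed
is joined to an unblocked ancestor of `u` by a co-ancestral chain
(`IsRepairSequence.exists_reach`). Conversely, given a co-ancestral chain without repetitions that
ends in the unblocked ancestor `s` of `v`, change the terms along the chain one by one, under the
graph function `spread` that ignores all terms but that of `s` and hands the value of `s` on to all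
descendants along paths avoiding `Z`. The values on `Z` never move, while the value of `v` changes
with the term of `s`. The value of `u` is not affected unless `s` is an unblocked ancestor of `u`,
and then the one-node chain `s` will do.
-/

namespace CausalModel

variable {V : Type*} {G : CausalModel V} {Z : Set V}

/-! ### Unblocked ancestors and linked nodes -/

/-- An edge `a → b` whose tail is not in the conditioning set. -/
def UnblockedEdge (G : CausalModel V) (Z : Set V) (a b : V) : Prop :=
  G.Adj a b ∧ a ∉ Z

/-- `a` reaches `w` by a directed path, possibly trivial, on which only `w` may lie in `Z`. -/
def Reaches (G : CausalModel V) (Z : Set V) (a w : V) : Prop :=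
  Relation.ReflTransGen (G.UnblockedEdge Z) a w

/-- `a` and `b` are unblocked ancestors of a common node of `Z`. -/
def CoAncestral (G : CausalModel V) (Z : Set V) (a b : V) : Prop :=
  ∃ z ∈ Z, G.Reaches Z a z ∧ G.Reaches Z b z

/-- A chain of co-ancestral nodes leads from an unblocked ancestor of `u` to one of `v`. -/
def Linked (G : CausalModel V) (Z : Set V) (u v : V) : Prop :=
  ∃ s t, G.Reaches Z s u ∧ Relation.ReflTransGen (G.CoAncestral Z) s t ∧ G.Reaches Z t v

theorem mem_unblockedAncestors {a w : V} :
    a ∈ G.unblockedAncestors Z w ↔ G.Reaches Z a w := by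
  rw [Reaches, Relation.reflTransGen_iff_eq_or_transGen, eq_comm (a := w)]
  rfl

theorem Reaches.eq_or_notMem {a w : V} (h : G.Reaches Z a w) : a = w ∨ a ∉ Z := by
  rcases Relation.ReflTransGen.cases_head h with h | ⟨b, hb, -⟩
  · exact Or.inl h
  · exact Or.inr hb.2

theorem Reaches.notMem {a w : V} (h : G.Reaches Z a w) (hw : w ∉ Z) : a ∉ Z := by
  rcases h.eq_or_notMem with rfl | h
  · exact hw
  · exact h

/-- A node with a descendant in `Z` is an unblocked ancestor of the first node of `Z` on the way. -/
theorem IsDescendant.exists_reaches {a z : V} (h : G.IsDescendant a z) (hz : z ∈ Z) :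
    ∃ z' ∈ Z, G.Reaches Z a z' := by
  induction h using Relation.ReflTransGen.head_induction_on with
  | refl => exact ⟨z, hz, .refl⟩
  | head hab _ ih =>
    rename_i a b _
    by_cases ha : a ∈ Z
    · exact ⟨a, ha, .refl⟩
    · obtain ⟨z', hz', hr⟩ := ih
      exact ⟨z', hz', .head ⟨hab, ha⟩ hr⟩

theorem CoAncestral.symm {a b : V} (h : G.CoAncestral Z a b) : G.CoAncestral Z b a := by
  obtain ⟨z, hz, ha, hb⟩ := h
  exact ⟨z, hz, hb, ha⟩

theorem not_adj_symm {a b : V} (h : G.Adj a b) : ¬ G.Adj b a := fun h' =>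
  G.acyclic a (.tail (.single h) h')

/-! ### Active walks -/

/-- The condition of d-connection on three consecutive nodes. -/
def IsOpenTriple (G : CausalModel V) (Z : Set V) (a b c : V) : Prop :=
  ((G.IsMediator a b c ∨ G.IsConfounder a b c) → b ∉ Z) ∧
    (G.IsCollider a b c → ∃ z ∈ Z, G.IsDescendant b z)

/-- `p` lists the nodes of an active walk: as a d-connecting path, but nodes may be repeated. -/
def IsActive (G : CausalModel V) (Z : Set V) (p : List V) : Prop :=
  p.IsChain (fun a b => G.Adj a b ∨ G.Adj b a) ∧
    ∀ a b c : V, [a, b, c] <:+: p → G.IsOpenTriple Z a b c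

theorem IsActive.infix {p q : List V} (hp : G.IsActive Z p) (h : q <:+: p) : G.IsActive Z q :=
  ⟨hp.1.infix h, fun a b c habc => hp.2 a b c (habc.trans h)⟩

theorem isActive_pair {a b : V} (h : G.Adj a b ∨ G.Adj b a) : G.IsActive Z [a, b] := by
  refine ⟨by simpa using h, fun x y z hxyz => ?_⟩
  have := hxyz.length_le
  simp at this

theorem isActive_cons {a b c : V} {l : List V} :
    G.IsActive Z (a :: b :: c :: l) ↔
      (G.Adj a b ∨ G.Adj b a) ∧ G.IsOpenTriple Z a b c ∧ G.IsActive Z (b :: c :: l) := by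
  constructor
  · intro h
    exact ⟨(List.isChain_cons_cons.1 h.1).1, h.2 a b c ⟨[], l, by simp⟩,
      h.infix (List.suffix_cons a _).isInfix⟩
  · rintro ⟨hab, habc, h⟩
    refine ⟨List.isChain_cons_cons.2 ⟨hab, h.1⟩, fun x y z hxyz => ?_⟩
    rcases List.infix_cons_iff.1 hxyz with hp | hi
    · simp only [List.cons_prefix_cons] at hp
      obtain ⟨rfl, rfl, rfl, -⟩ := hp
      exact habc
    · exact h.2 x y z hi

/-- A triple in `l₁ ++ x :: l₂` lies on one side of `x`, or is centred at `x`. -/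
theorem infix_append_cons {a b c x : V} {l₁ l₂ : List V} (h : [a, b, c] <:+: l₁ ++ x :: l₂) :
    [a, b, c] <:+: l₁ ++ [x] ∨ [a, b, c] <:+: x :: l₂ ∨
      b = x ∧ (∃ l, l₁ = l ++ [a]) ∧ ∃ l, l₂ = c :: l := by
  induction l₁ with
  | nil => exact Or.inr (Or.inl h)
  | cons y l₁ ih =>
    rw [List.cons_append, List.infix_cons_iff] at h
    rcases h with h | h
    · match l₁, h with
      | [], h =>
        simp only [List.nil_append, List.cons_prefix_cons] at h
        obtain ⟨rfl, rfl, m, rfl⟩ := h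
        exact Or.inr (Or.inr ⟨rfl, ⟨[], rfl⟩, m, rfl⟩)
      | [t], h =>
        simp only [List.cons_append, List.nil_append, List.cons_prefix_cons] at h
        obtain ⟨rfl, rfl, rfl, -⟩ := h
        exact Or.inl (List.infix_refl _)
      | t :: t' :: m, h =>
        simp only [List.cons_append, List.cons_prefix_cons] at h
        obtain ⟨rfl, rfl, rfl, -⟩ := h
        exact Or.inl ⟨[], m ++ [x], by simp⟩
    · rcases ih h with h | h | ⟨hb, ⟨l, rfl⟩, hc⟩
      · exact Or.inl (h.trans (List.suffix_cons y _).isInfix)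
      · exact Or.inr (Or.inl h)
      · exact Or.inr (Or.inr ⟨hb, ⟨y :: l, rfl⟩, hc⟩)

/-- An active walk that starts downwards either runs down to its end or meets a collider, below
which there is a node of `Z`. -/
theorem IsActive.transGen_or_exists {a b e : V} {l : List V} (hab : G.Adj a b)
    (h : G.IsActive Z (a :: b :: l)) (he : (b :: l).getLast? = some e) :
    Relation.TransGen G.Adj a e ∨ ∃ z ∈ Z, G.IsDescendant a z := by
  induction l generalizing a b with
  | nil =>
    obtain rfl : b = e := by simpa using he
    exact Or.inl (.single hab)
  | cons c l ih =>
    obtain ⟨-, habc, h'⟩ := isActive_cons.1 h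
    rcases (List.isChain_cons_cons.1 h'.1).1 with hbc | hcb
    · rcases ih hbc h' (by simpa using he) with ht | ⟨z, hz, hd⟩
      · exact Or.inl (.head hab ht)
      · exact Or.inr ⟨z, hz, .head hab hd⟩
    · obtain ⟨z, hz, hd⟩ := habc.2 ⟨hab, hcb⟩
      exact Or.inr ⟨z, hz, .head hab hd⟩

/-- A loop of an active walk can be cut out. -/
theorem IsActive.cut {l₁ l₂ l₃ : List V} {x : V}
    (h : G.IsActive Z (l₁ ++ x :: (l₂ ++ x :: l₃))) : G.IsActive Z (l₁ ++ x :: l₃) := by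
  have hl : G.IsActive Z (l₁ ++ [x]) := h.infix ⟨[], l₂ ++ x :: l₃, by simp⟩
  have hr : G.IsActive Z (x :: l₃) := h.infix ⟨l₁ ++ x :: l₂, [], by simp⟩
  have hm : G.IsActive Z (x :: (l₂ ++ [x])) := h.infix ⟨l₁, l₃, by simp⟩
  refine ⟨List.isChain_split.2 ⟨hl.1, hr.1⟩, fun a b c habc => ?_⟩
  rcases infix_append_cons habc with habc | habc | ⟨rfl, ⟨l, rfl⟩, l', rfl⟩
  · exact hl.2 _ _ _ habc
  · exact hr.2 _ _ _ habc
  -- `d` follows the first occurrence of `b`, and `e` precedes the second one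
  obtain ⟨d, m, hd⟩ : ∃ d m, l₂ ++ [b] = d :: m := by
    cases l₂ with
    | nil => exact ⟨b, [], rfl⟩
    | cons d m => exact ⟨d, m ++ [b], rfl⟩
  obtain ⟨m', e, he⟩ : ∃ m' e, b :: l₂ = m' ++ [e] :=
    ⟨_, _, (List.dropLast_append_getLast (List.cons_ne_nil b l₂)).symm⟩
  have hfst : G.IsOpenTriple Z a b d := h.2 a b d
    ⟨l, m ++ c :: l', by
      have : l₂ ++ b :: c :: l' = (l₂ ++ [b]) ++ c :: l' := by simp
      rw [this, hd]; simp⟩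
  have hsnd : G.IsOpenTriple Z e b c := h.2 e b c
    ⟨l ++ [a] ++ m', l', by
      have : l ++ [a] ++ b :: (l₂ ++ b :: c :: l') = l ++ [a] ++ (b :: l₂) ++ b :: c :: l' := by
        simp
      rw [this, he]; simp⟩
  rw [hd] at hm
  have hbd : G.Adj b d ∨ G.Adj d b := (List.isChain_cons_cons.1 hm.1).1
  have heb : G.Adj e b ∨ G.Adj b e := by
    have h2 : G.IsActive Z [e, b] := h.infix ⟨l ++ [a] ++ m', c :: l', by
      have : l ++ [a] ++ b :: (l₂ ++ b :: c :: l') = l ++ [a] ++ (b :: l₂) ++ b :: c :: l' := by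
        simp
      rw [this, he]; simp⟩
    simpa using h2.1
  -- a triple at `b` with an edge out of `b` is no collider
  have hc : G.Adj b c → b ∉ Z := fun hbc => hsnd.1 <| heb.imp (fun h => Or.inl ⟨h, hbc⟩)
    (fun h => ⟨h, hbc⟩)
  have ha : G.Adj b a → b ∉ Z := fun hba => hfst.1 <| hbd.symm.imp (fun h => Or.inr ⟨hba, h⟩)
    (fun h => ⟨hba, h⟩)
  refine ⟨?_, fun ⟨hab, hcb⟩ => ?_⟩
  · rintro ((⟨-, h⟩ | ⟨h, -⟩) | ⟨h, -⟩)
    exacts [hc h, ha h, ha h]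
  · rcases hbd with hbd | hdb
    · refine (hm.transGen_or_exists hbd (e := b) ?_).resolve_left (G.acyclic b)
      rw [← hd]; simp
    · exact hfst.2 ⟨hab, hdb⟩

/-- A shortest active walk is a path. -/
theorem IsActive.dConnected {u v : V} (huv : u ≠ v) {p : List V} (hp : G.IsActive Z p)
    (hu : p.head? = some u) (hv : p.getLast? = some v) : G.DConnected Z u v := by
  induction hn : p.length using Nat.strong_induction_on generalizing p with
  | _ n ih =>
  by_cases hnd : p.Nodup
  · obtain ⟨q, rfl⟩ := List.head?_eq_some_iff.1 hu
    rcases List.eq_nil_or_concat q with rfl | ⟨l, w, rfl⟩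
    · exact absurd (by simpa using hv) huv
    · rw [List.concat_eq_append] at hp hnd hv
      rw [← List.cons_append, List.getLast?_concat, Option.some_inj] at hv
      subst hv
      exact ⟨l, ⟨hp.1, hnd⟩, hp.2⟩
  · obtain ⟨x, hx⟩ : ∃ x, List.Duplicate x p := by
      by_contra! h
      exact hnd (List.nodup_iff_forall_not_duplicate.2 h)
    obtain ⟨l₁, l₂, l₃, rfl⟩ : ∃ l₁ l₂ l₃, p = l₁ ++ x :: (l₂ ++ x :: l₃) := by
      clear hp hu hv hn hnd ih
      induction hx with
      | cons_mem h =>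
        obtain ⟨s, t, rfl⟩ := List.append_of_mem h
        exact ⟨[], s, t, rfl⟩
      | cons_duplicate _ ih =>
        obtain ⟨l₁, l₂, l₃, rfl⟩ := ih
        exact ⟨_ :: l₁, l₂, l₃, rfl⟩
    refine ih _ ?_ hp.cut ?_ ?_ rfl
    · rw [← hn]; simp only [List.length_append, List.length_cons]; omega
    · cases l₁ <;> simpa using hu
    · cases l₃ <;> simpa [List.getLast?_append, List.getLast?_cons] using hv

/-! ### d-connected nodes are linked -/

/-- Along the walk, a start outside `Z` with an edge downwards has a co-ancestral chain to an
unblocked ancestor of `v`, and so has, if the first edge goes upwards, some unblocked ancestor of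
the start. -/
theorem IsActive.chain_of_adj {v : V} (hv : v ∉ Z) {a b : V} {l : List V}
    (h : G.IsActive Z (a :: b :: l)) (hl : (b :: l).getLast? = some v) :
    (G.Adj a b → a ∉ Z →
      ∃ t, Relation.ReflTransGen (G.CoAncestral Z) a t ∧ G.Reaches Z t v) ∧
    (G.Adj b a → ∃ s t, G.Reaches Z s a ∧
      Relation.ReflTransGen (G.CoAncestral Z) s t ∧ G.Reaches Z t v) := by
  induction l generalizing a b with
  | nil =>
    obtain rfl : b = v := by simpa using hl
    exact ⟨fun hab ha => ⟨a, .refl, .single ⟨hab, ha⟩⟩,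
      fun hba => ⟨b, b, .single ⟨hba, hv⟩, .refl, .refl⟩⟩
  | cons c l ih =>
    obtain ⟨-, habc, h'⟩ := isActive_cons.1 h
    obtain ⟨ih₁, ih₂⟩ := ih h' (by simpa using hl)
    rcases (List.isChain_cons_cons.1 h'.1).1 with hbc | hcb
    · refine ⟨fun hab ha => ?_, fun hba => ?_⟩
      · obtain ⟨t, hbt, htv⟩ := ih₁ hbc (habc.1 (Or.inl (Or.inl ⟨hab, hbc⟩)))
        -- `a` is an unblocked ancestor of everything of which `b` is one
        rcases Relation.ReflTransGen.cases_head hbt with rfl | ⟨b', ⟨z, hz, hbz, hb'z⟩, hb't⟩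
        · exact ⟨a, .refl, .head ⟨hab, ha⟩ htv⟩
        · exact ⟨t, .head ⟨z, hz, .head ⟨hab, ha⟩ hbz, hb'z⟩ hb't, htv⟩
      · have hb := habc.1 (Or.inr ⟨hba, hbc⟩)
        obtain ⟨t, hbt, htv⟩ := ih₁ hbc hb
        exact ⟨b, t, .single ⟨hba, hb⟩, hbt, htv⟩
    · obtain ⟨s, t, hsb, hst, htv⟩ := ih₂ hcb
      refine ⟨fun hab ha => ?_, fun hba => ?_⟩
      · obtain ⟨z, hz, hbz⟩ := habc.2 ⟨hab, hcb⟩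
        obtain ⟨z', hz', hbz'⟩ := hbz.exists_reaches hz
        exact ⟨t, .head ⟨z', hz', .head ⟨hab, ha⟩ hbz', hsb.trans hbz'⟩ hst, htv⟩
      · exact ⟨s, t, hsb.tail ⟨hba, habc.1 (Or.inl (Or.inr ⟨hba, hcb⟩))⟩, hst, htv⟩

theorem DConnected.linked {u v : V} (hu : u ∉ Z) (hv : v ∉ Z) (h : G.DConnected Z u v) :
    G.Linked Z u v := by
  obtain ⟨l, ⟨hc, -⟩, ht⟩ := h
  have hact : G.IsActive Z (u :: (l ++ [v])) := ⟨hc, ht⟩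
  obtain ⟨b, m, hb⟩ : ∃ b m, l ++ [v] = b :: m := by
    cases l with
    | nil => exact ⟨v, [], rfl⟩
    | cons d m => exact ⟨d, m ++ [v], rfl⟩
  have hlast : (b :: m).getLast? = some v := by rw [← hb]; simp
  rw [hb] at hact
  obtain ⟨h₁, h₂⟩ := hact.chain_of_adj hv hlast
  rcases (List.isChain_cons_cons.1 hact.1).1 with hub | hbu
  · obtain ⟨t, hut, htv⟩ := h₁ hub hu
    exact ⟨u, t, .refl, hut, htv⟩
  · exact h₂ hbu

/-! ### Linked nodes are d-connected -/

/-- An active walk leads from `a` to `v` and starts with an edge out of `a`. -/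
def ActiveDown (G : CausalModel V) (Z : Set V) (v a : V) : Prop :=
  ∃ b l, G.Adj a b ∧ G.IsActive Z (a :: b :: l) ∧ (b :: l).getLast? = some v

/-- An active walk leads from `a` to `v` and starts with an edge into `a`. -/
def ActiveUp (G : CausalModel V) (Z : Set V) (v a : V) : Prop :=
  ∃ b l, G.Adj b a ∧ G.IsActive Z (a :: b :: l) ∧ (b :: l).getLast? = some v

/-- An active walk, possibly trivial, leads from `a` to `v`. -/
def ActiveFrom (G : CausalModel V) (Z : Set V) (v a : V) : Prop :=
  a = v ∨ G.ActiveDown Z v a ∨ G.ActiveUp Z v a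

theorem ActiveUp.of_edge {v a b : V} (hba : G.UnblockedEdge Z b a) (h : G.ActiveFrom Z v b) :
    G.ActiveUp Z v a := by
  obtain ⟨hba, hb⟩ := hba
  rcases h with rfl | ⟨c, l, hbc, hact, hl⟩ | ⟨c, l, hcb, hact, hl⟩
  · exact ⟨b, [], hba, isActive_pair (Or.inr hba), rfl⟩
  · exact ⟨b, c :: l, hba, isActive_cons.2 ⟨Or.inr hba,
      ⟨fun _ => hb, fun h => absurd h.1 (not_adj_symm hba)⟩, hact⟩, by simpa using hl⟩
  · exact ⟨b, c :: l, hba, isActive_cons.2 ⟨Or.inr hba,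
      ⟨fun _ => hb, fun h => absurd h.1 (not_adj_symm hba)⟩, hact⟩, by simpa using hl⟩

theorem ActiveFrom.up_of_reaches {v s w : V} (h : G.ActiveFrom Z v s) (hsw : G.Reaches Z s w) :
    s = w ∨ G.ActiveUp Z v w := by
  induction hsw with
  | refl => exact Or.inl rfl
  | tail _ hbc ih =>
    rcases ih with rfl | ih
    · exact Or.inr (.of_edge hbc h)
    · exact Or.inr (.of_edge hbc (Or.inr (Or.inr ih)))

theorem ActiveUp.down_of_reaches {v a z : V} (hz : z ∈ Z) (h : G.ActiveUp Z v z)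
    (haz : G.Reaches Z a z) : a = z ∨ G.ActiveDown Z v a := by
  induction haz using Relation.ReflTransGen.head_induction_on with
  | refl => exact Or.inl rfl
  | head hab _ ih =>
    rename_i a b _
    obtain ⟨hab, -⟩ := hab
    refine Or.inr ?_
    by_cases hbz : b = z
    · obtain rfl := hbz
      obtain ⟨c, l, hcb, hact, hl⟩ := h
      refine ⟨b, c :: l, hab, isActive_cons.2 ⟨Or.inl hab, ⟨?_, fun _ => ⟨b, hz, .refl⟩⟩, hact⟩,
        by simpa using hl⟩
      rintro ((⟨-, h⟩ | ⟨h, -⟩) | ⟨h, -⟩)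
      exacts [absurd h (not_adj_symm hcb), absurd h (not_adj_symm hab),
        absurd h (not_adj_symm hab)]
    · rename_i hbz'
      obtain ⟨c, l, hbc, hact, hl⟩ := ih.resolve_left hbz
      exact ⟨b, c :: l, hab, isActive_cons.2 ⟨Or.inl hab,
        ⟨fun _ => (Reaches.eq_or_notMem hbz').resolve_left hbz,
          fun h => absurd h.2 (not_adj_symm hbc)⟩, hact⟩, by simpa using hl⟩

theorem ActiveDown.of_reaches {v a : V} (hav : G.Reaches Z a v) :
    a = v ∨ G.ActiveDown Z v a := by
  induction hav using Relation.ReflTransGen.head_induction_on with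
  | refl => exact Or.inl rfl
  | head hab hbv ih =>
    rename_i a b
    obtain ⟨hab, -⟩ := hab
    by_cases hb : b = v
    · obtain rfl := hb
      exact Or.inr ⟨b, [], hab, isActive_pair (Or.inl hab), rfl⟩
    · obtain ⟨c, l, hbc, hact, hl⟩ := ih.resolve_left hb
      exact Or.inr ⟨b, c :: l, hab, isActive_cons.2 ⟨Or.inl hab,
        ⟨fun _ => (Reaches.eq_or_notMem hbv).resolve_left hb,
          fun h => absurd h.2 (not_adj_symm hbc)⟩, hact⟩, by simpa using hl⟩

/-- A node of `Z` is an unblocked ancestor of no other node of `Z`, so a co-ancestral chain can skip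
it: a chain that starts outside `Z` at `a` and ends outside `Z` gives an active walk from `a`. The
second part is the invariant for chains that start in `Z`. -/
theorem activeFrom_of_chain {v a t : V} (hv : v ∉ Z) (htv : G.Reaches Z t v)
    (hat : Relation.ReflTransGen (G.CoAncestral Z) a t) :
    (a ∉ Z → G.ActiveFrom Z v a) ∧ (a ∈ Z → G.ActiveUp Z v a) := by
  induction hat using Relation.ReflTransGen.head_induction_on with
  | refl =>
    exact ⟨fun _ => (ActiveDown.of_reaches htv).imp_right Or.inl, fun h => absurd h (htv.notMem hv)⟩
  | head hab _ ih =>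
    rename_i a b _
    obtain ⟨z, hz, haz, hbz⟩ := hab
    have hup : G.ActiveUp Z v z := by
      by_cases hb : b ∈ Z
      · obtain rfl : b = z := hbz.eq_or_notMem.resolve_right (not_not_intro hb)
        exact ih.2 hb
      · refine ((ih.1 hb).up_of_reaches hbz).resolve_left ?_
        rintro rfl
        exact hb hz
    refine ⟨fun ha => ?_, fun ha => ?_⟩
    · refine Or.inr (Or.inl ((hup.down_of_reaches hz haz).resolve_left ?_))
      rintro rfl
      exact ha hz
    · obtain rfl : a = z := haz.eq_or_notMem.resolve_right (not_not_intro ha)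
      exact hup

theorem Linked.exists_isActive {u v : V} (huv : u ≠ v) (hu : u ∉ Z) (hv : v ∉ Z)
    (h : G.Linked Z u v) :
    ∃ p, G.IsActive Z p ∧ p.head? = some u ∧ p.getLast? = some v := by
  obtain ⟨s, t, hsu, hst, htv⟩ := h
  have hs := (activeFrom_of_chain hv htv hst).1 (hsu.notMem hu)
  have hfrom : G.ActiveFrom Z v u := by
    rcases hs.up_of_reaches hsu with rfl | h
    · exact hs
    · exact Or.inr (Or.inr h)
  rcases hfrom.resolve_left huv with ⟨b, l, -, hact, hl⟩ | ⟨b, l, -, hact, hl⟩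
  all_goals exact ⟨_, hact, rfl, by simpa using hl⟩

theorem dConnected_iff_linked {u v : V} (huv : u ≠ v) (hu : u ∉ Z) (hv : v ∉ Z) :
    G.DConnected Z u v ↔ G.Linked Z u v := by
  refine ⟨fun h => h.linked hu hv, fun h => ?_⟩
  obtain ⟨p, hp, hpu, hpv⟩ := h.exists_isActive huv hu hv
  exact hp.dConnected huv hpu hpv

/-! ### Repair sequences only change linked nodes -/

variable {X : Type*}

/-- The value of `w` is determined by the values on `Z` and the unobserved terms on the unblocked
ancestors of `w`. -/
theorem eval_congr [Finite V] (f : G.GraphFun X) {U U' : V → X}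
    (hZ : ∀ z ∈ Z, eval f U z = eval f U' z) (w : V) (hU : ∀ a, G.Reaches Z a w → U a = U' a) :
    eval f U w = eval f U' w := by
  induction w using G.wellFounded_adj.induction with
  | _ w ih =>
  rw [eval_eq, eval_eq f U', hU w .refl]
  congr 1
  funext ⟨p, hp⟩
  by_cases hpZ : p ∈ Z
  · exact hZ p hpZ
  · exact ih p hp fun a ha => hU a (ha.tail ⟨hp, hpZ⟩)

theorem IsRepairSequence.exists_reach [Fintype V] {f : G.GraphFun X} {A : Z → X} {u : V}
    {α β : X} {ℓ : ℕ} {U : ℕ → V → X} (h : IsRepairSequence f A u α β ℓ U) {i : ℕ} (hi : i < ℓ)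
    {a : V} (ha : U (i + 1) a ≠ U i a) :
    ∃ s, G.Reaches Z s u ∧ Relation.ReflTransGen (G.CoAncestral Z) s a := by
  induction i generalizing a with
  | zero => exact ⟨a, mem_unblockedAncestors.1 (h.catalyst.2 a ha), .refl⟩
  | succ i ih =>
    obtain ⟨z, hz, ⟨b, hbz, hb⟩, haz⟩ := h.repair (i + 2) (by omega) (by omega) a ha
    obtain ⟨s, hsu, hsb⟩ := ih (by omega) (Ne.symm hb)
    exact ⟨s, hsu, hsb.tail
      ⟨z, hz, mem_unblockedAncestors.1 hbz, mem_unblockedAncestors.1 haz⟩⟩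

theorem IsRepairSequence.linked [Fintype V] {f : G.GraphFun X} {A : Z → X} {u v : V} {α β : X}
    {ℓ : ℕ} {U : ℕ → V → X} (h : IsRepairSequence f A u α β ℓ U)
    (hne : eval f (U 0) v ≠ eval f (U ℓ) v) : G.Linked Z u v := by
  obtain ⟨t, htv, ht⟩ : ∃ t, G.Reaches Z t v ∧ U 0 t ≠ U ℓ t := by
    by_contra! hU
    refine hne (eval_congr f (fun z hz => ?_) v hU)
    rw [h.initialization.2 ⟨z, hz⟩, h.restored.2 ⟨z, hz⟩]
  obtain ⟨i, hi, hne⟩ : ∃ i < ℓ, U (i + 1) t ≠ U i t := by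
    by_contra! hU
    have : ∀ i ≤ ℓ, U i t = U 0 t := by
      intro i
      induction i with
      | zero => exact fun _ => rfl
      | succ i ih => exact fun hi => (hU i hi).trans (ih (by omega))
    exact ht (this ℓ le_rfl).symm
  obtain ⟨s, hsu, hst⟩ := h.exists_reach hi hne
  exact ⟨s, t, hsu, hst, htv⟩

/-! ### A repair sequence along a chain of co-ancestral nodes -/

open Classical in
/-- With `x₁` as "on" and `x₀` as "off", the node `s` is switched by its unobserved term, a node is
switched on by any parent that is on, and nodes of `Z` are always off. -/
noncomputable def spread (G : CausalModel V) (Z : Set V) (s : V) (x₀ x₁ : X) : G.GraphFun X :=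
  fun w Uw pa => if w ∉ Z ∧ ((w = s ∧ Uw = x₁) ∨ ∃ p, pa p = x₁) then x₁ else x₀

open Classical in
theorem eval_spread [Finite V] {s : V} {x₀ x₁ : X} (hx : x₀ ≠ x₁) (U : V → X) (w : V) :
    eval (G.spread Z s x₀ x₁) U w =
      if w ∉ Z ∧ U s = x₁ ∧ G.Reaches Z s w then x₁ else x₀ := by
  induction w using G.wellFounded_adj.induction with
  | _ w ih =>
  rw [eval_eq]
  refine if_congr (and_congr_right fun hw => ⟨?_, ?_⟩) rfl rfl
  · rintro (⟨rfl, hU⟩ | ⟨⟨p, hp⟩, hpx⟩)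
    · exact ⟨hU, .refl⟩
    · simp only [ih p hp] at hpx
      split_ifs at hpx with hc
      · exact ⟨hc.2.1, hc.2.2.tail ⟨hp, hc.1⟩⟩
      · exact absurd hpx hx
  · rintro ⟨hU, hsw⟩
    rcases Relation.ReflTransGen.cases_tail hsw with rfl | ⟨p, hsp, hp, hpZ⟩
    · exact Or.inl ⟨rfl, hU⟩
    · refine Or.inr ⟨⟨p, hp⟩, ?_⟩
      simp only [ih p hp]
      exact if_pos ⟨hpZ, hU, hsp⟩

open Classical in
theorem Linked.not_semanticallySeparated [Fintype V] [Nontrivial X] {u v : V} (hv : v ∉ Z)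
    (h : G.Linked Z u v) : ¬ G.SemanticallySeparated X Z u v := by
  obtain ⟨x₀, x₁, hx⟩ := exists_pair_ne X
  -- if the last node of the chain is an unblocked ancestor of `u`, the chain may start there
  obtain ⟨s, t, hsu, hst, htv, hut⟩ : ∃ s t, G.Reaches Z s u ∧
      Relation.ReflTransGen (G.CoAncestral Z) s t ∧ G.Reaches Z t v ∧
        (G.Reaches Z t u → s = t) := by
    obtain ⟨s, t, hsu, hst, htv⟩ := h
    by_cases htu : G.Reaches Z t u
    · exact ⟨t, t, htu, .refl, htv, fun _ => rfl⟩
    · exact ⟨s, t, hsu, hst, htv, fun h => absurd h htu⟩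
  -- a chain without repetitions keeps within the bound on `ℓ`
  obtain ⟨p, hp⟩ : ∃ p : (SimpleGraph.fromRel (G.CoAncestral Z)).Walk s t, p.IsPath := by
    have hreach : (SimpleGraph.fromRel (G.CoAncestral Z)).Reachable s t := by
      clear htv hut
      induction hst with
      | refl => exact .refl _
      | tail _ hbc ih =>
        rename_i b c _
        by_cases hbc' : b = c
        · exact hbc' ▸ ih
        · exact ih.trans (SimpleGraph.Adj.reachable
            ((SimpleGraph.fromRel_adj _ _ _).2 ⟨hbc', Or.inl hbc⟩))
    exact hreach.exists_isPath
  let U : ℕ → V → X := fun i a => if ∃ j < i, p.getVert j = a then x₁ else x₀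
  have hstep : ∀ i a, U (i + 1) a ≠ U i a → a = p.getVert i := by
    intro i a hne
    by_contra ha
    refine hne (if_congr ⟨?_, ?_⟩ rfl rfl)
    · rintro ⟨j, hj, rfl⟩
      exact ⟨j, lt_of_le_of_ne (by omega) fun h => ha (by rw [h]), rfl⟩
    · rintro ⟨j, hj, rfl⟩
      exact ⟨j, by omega, rfl⟩
  have hU0 : ∀ a, U 0 a = x₀ := fun a => if_neg (by simp)
  have hUt : U (p.length + 1) t = x₁ := if_pos ⟨p.length, by omega, p.getVert_length⟩
  have hZ : ∀ U : V → X, ∀ z ∈ Z, eval (G.spread Z t x₀ x₁) U z = x₀ := fun U z hz => by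
    rw [eval_spread hx, if_neg fun h => h.1 hz]
  have hu : eval (G.spread Z t x₀ x₁) (U (p.length + 1)) u =
      eval (G.spread Z t x₀ x₁) (U 1) u := by
    rw [eval_spread hx, eval_spread hx]
    by_cases htu : G.Reaches Z t u
    · have hU1 : U 1 t = x₁ := if_pos ⟨0, one_pos, by rw [p.getVert_zero, hut htu]⟩
      rw [hUt, hU1]
    · rw [if_neg fun h => htu h.2.2, if_neg fun h => htu h.2.2]
  intro hsep
  have heq := hsep (G.spread Z t x₀ x₁) _ _ (fun _ => x₀) (p.length + 1) U
    { initialization := ⟨rfl, fun z => hZ _ z z.2⟩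
      catalyst := ⟨rfl, fun a ha => by
        rw [hstep 0 a ha, p.getVert_zero]
        exact mem_unblockedAncestors.2 hsu⟩
      repair := fun i h2 hi a ha => by
        obtain ⟨k, rfl⟩ : ∃ k, i = k + 2 := ⟨i - 2, by omega⟩
        have hk : k < p.length := by omega
        obtain rfl := hstep (k + 1) a ha
        obtain ⟨-, hco⟩ := (SimpleGraph.fromRel_adj _ _ _).1 (p.adj_getVert_succ hk)
        obtain ⟨z, hz, hkz, hkz'⟩ := hco.elim id CoAncestral.symm
        refine ⟨z, hz, ⟨p.getVert k, mem_unblockedAncestors.2 hkz, ?_⟩,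
          mem_unblockedAncestors.2 hkz'⟩
        have h0 : U k (p.getVert k) = x₀ := if_neg <| by
          rintro ⟨j, hj, hjk⟩
          exact hj.ne (hp.getVert_injOn (by simp; omega) (by simp; omega) hjk)
        have h1 : U (k + 1) (p.getVert k) = x₁ := if_pos ⟨k, by omega, rfl⟩
        show U k _ ≠ U (k + 1) _
        rw [h0, h1]
        exact hx
      termination := ⟨by omega, by have := hp.length_lt; omega⟩
      restored := ⟨hu, fun z => hZ _ z z.2⟩ }
  rw [eval_spread hx, eval_spread hx, if_neg (fun h => hx ((hU0 t).symm.trans h.2.1)),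
    if_pos ⟨hv, hUt, htv⟩] at heq
  exact hx heq

end CausalModel

theorem theorem1 {V : Type*} [Fintype V] (G : CausalModel V) {X : Type*} [Nontrivial X]
    (u v : V) (huv : u ≠ v) (Z : Set V) (hu : u ∉ Z) (hv : v ∉ Z) :
    G.SemanticallySeparated X Z u v ↔ G.DSeparated Z u v := by
  rw [CausalModel.DSeparated, CausalModel.dConnected_iff_linked huv hu hv]
  refine ⟨fun h hlink => hlink.not_semanticallySeparated hv h, fun h f α β A ℓ U hU => ?_⟩
  by_contra hne
  exact h (hU.linked hne)
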